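/- Let $r\ge k\ge 2$ be integers. For real $x$ let $N_{r,k}(x)$ denote the number of $r$-tuples $(n_1,\ldots,n_r)$ of positive integers $n_i\le x$ whose components are $k$-wise relatively prime, that is, $\gcd(n_{i_1},\ldots,n_{i_k})=1$ for all $1\le i_1<\cdots<i_k\le r$. Then, for $x\ge 2$, $$N_{r,k}(x)=A_{r,k}\,x^r+O\bigl(R_{r,k}(x)\bigr),$$ where the implied constant depends only on $r$, $$A_{r,k}=\prod_p\left(1-\sum_{j=k}^r(-1)^{j-k}\binom{r}{j}\binom{j-1}{k-1}\frac1{p^j}\right)$$ is a convergent product over all primes $p$ (absolutely convergent: independent of the order of the factors), and $$R_{r,k}(x)=\begin{cases}x^{r-1},&\text{if } r\ge k\ge 3,\\ x^{r-1}(\log x)^{r-1},&\text{if } r\ge k=2.\end{cases}$$ -/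

import Mathlib

/-- The components of `n = (n₁, …, n_r)` are `k`-wise relatively prime: any `k` of them
(at `k` distinct positions) have greatest common divisor `1`. -/
def KWiseCoprime {r : ℕ} (k : ℕ) (n : Fin r → ℕ) : Prop :=
  ∀ s : Finset (Fin r), s.card = k → s.gcd n = 1

open Classical in
/-- The characteristic function of the set of `r`-tuples of positive integers with `k`-wise
relatively prime components. -/
noncomputable def rho (r k : ℕ) (n : Fin r → ℕ) : ℕ :=
  if (∀ i, 0 < n i) ∧ KWiseCoprime k n then 1 else 0

/-- The sum of `rho r k (n₁, …, n_r)` over all positive integers `n₁, …, n_r ≤ x`,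
that is, the number of `k`-wise relatively prime `r`-tuples with components up to `x`. -/
noncomputable def rhoSum (r k : ℕ) (x : ℝ) : ℕ :=
  ∑ n ∈ Fintype.piFinset (fun _ : Fin r => Finset.Icc 1 ⌊x⌋₊), rho r k n

/-- The factor at `p` of the Euler product `A_{r,k}`. -/
noncomputable def eulerFactor (r k : ℕ) (p : Nat.Primes) : ℝ :=
  1 - ∑ j ∈ Finset.Icc k r,
    (-1 : ℝ) ^ (j - k) * (r.choose j : ℝ) * ((j - 1).choose (k - 1) : ℝ)
      * (1 / ((p : ℕ) : ℝ) ^ j)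

/-- The constant `A_{r,k}`, a product over all primes. -/
noncomputable def mainConst (r k : ℕ) : ℝ :=
  ∏' p : Nat.Primes, eulerFactor r k p

/-- The error function `R_{r,k}(x)`, for `2 ≤ k ≤ r`. -/
noncomputable def errorBound (r k : ℕ) (x : ℝ) : ℝ :=
  if 3 ≤ k then x ^ (r - 1) else x ^ (r - 1) * Real.log x ^ (r - 1)

/-! A tuple is `k`-wise coprime iff each prime divides fewer than `k` components.
`sum_powerset_thresholdCoeff` writes this local condition as a sum over sets of divisible
coordinates. Multiplying over primes up to `x` and counting multiples (`rhoSum_eq_sum`) gives a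
weighted sum of products `∏ i, ⌊x / d i⌋`.

Dropping the floors turns the sum into `x ^ r` times a partial Euler product. Its tail is `1 +
O(1/x)`, so completing it costs `O(x ^ (r - 1))` (`abs_prod_primesBelow_sub_mainConst_le`).

For the floor error, Rankin's trick `y - ⌊y⌋ ≤ y ^ ε` (`abs_rhoSum_sub_le`) gives `x ^ (r - 1 + ε)`
times Euler products in which one coordinate has exponent `ε` instead of `1`. If `k ≥ 3`, take `ε =
0`: every nonempty contributing set keeps two full exponents, so the products are bounded. If `k =
2`, pairs through the special coordinate contribute `p ^ (-(1 + ε))`, hence at most a constant times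
`(1 + ε⁻¹) ^ (r - 1)`; taking `ε` of order `1 / log x` yields the logarithms. -/

/-! ### Threshold coefficients and the Euler factors -/

/-- The coefficients `c k j` for which `∑ S ⊆ T, c k #S` is the indicator of `#T < k`. -/
noncomputable def thresholdCoeff : ℕ → ℕ → ℝ
  | 0, _ => 0
  | _ + 1, 0 => 1
  | k + 1, j + 1 => thresholdCoeff k j - thresholdCoeff (k + 1) j

theorem thresholdCoeff_zero_right {k : ℕ} (hk : k ≠ 0) : thresholdCoeff k 0 = 1 := by
  cases k with
  | zero => exact absurd rfl hk
  | succ k => simp [thresholdCoeff]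

/-- Pairing each `S` with `insert a S`, the recursion for `thresholdCoeff` cancels the level `k + 1`
terms and leaves the sum for `T` at level `k`. -/
theorem sum_powerset_thresholdCoeff {α : Type*} (k : ℕ) (T : Finset α) :
    ∑ S ∈ T.powerset, thresholdCoeff k S.card = if T.card < k then 1 else 0 := by
  classical
  induction T using Finset.induction_on generalizing k with
  | empty => cases k <;> simp [thresholdCoeff]
  | insert a T ha ih =>
    cases k with
    | zero => simp [thresholdCoeff]
    | succ k =>
      rw [Finset.sum_powerset_insert ha, Finset.card_insert_of_notMem ha]
      have : ∑ S ∈ T.powerset, thresholdCoeff (k + 1) (insert a S).card =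
          ∑ S ∈ T.powerset, (thresholdCoeff k S.card - thresholdCoeff (k + 1) S.card) := by
        refine Finset.sum_congr rfl fun S hS => ?_
        rw [Finset.card_insert_of_notMem fun h => ha (Finset.mem_powerset.1 hS h), thresholdCoeff]
      rw [this, Finset.sum_sub_distrib, add_sub_cancel, ih k]
      simp

theorem thresholdCoeff_succ_succ (k j : ℕ) :
    thresholdCoeff (k + 1) (j + 1) = (-1) ^ (j + k + 1) * (j.choose k : ℝ) := by
  induction j generalizing k with
  | zero => cases k <;> simp [thresholdCoeff]
  | succ j ih =>
    cases k with
    | zero =>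
      rw [thresholdCoeff, ih]
      simp [thresholdCoeff, pow_succ]
    | succ k =>
      rw [thresholdCoeff, ih, ih, Nat.choose_succ_succ]
      push_cast
      ring

theorem thresholdCoeff_eq_zero {k j : ℕ} (hj : j ≠ 0) (hjk : j < k) : thresholdCoeff k j = 0 := by
  obtain ⟨j, rfl⟩ := Nat.exists_eq_succ_of_ne_zero hj
  obtain ⟨k, rfl⟩ := Nat.exists_eq_succ_of_ne_zero (Nat.ne_of_gt (Nat.zero_lt_of_lt hjk))
  rw [Nat.succ_eq_add_one, thresholdCoeff_succ_succ, Nat.choose_eq_zero_of_lt (by omega)]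
  simp

theorem abs_thresholdCoeff_le (k j : ℕ) : |thresholdCoeff k j| ≤ 2 ^ j := by
  induction j generalizing k with
  | zero => cases k <;> simp [thresholdCoeff]
  | succ j ih =>
    cases k with
    | zero => simp [thresholdCoeff]
    | succ k =>
      rw [thresholdCoeff]
      have h := abs_sub (thresholdCoeff k j) (thresholdCoeff (k + 1) j)
      rw [pow_succ]
      linarith [ih k, ih (k + 1)]

theorem eulerFactor_eq_sum {r k : ℕ} (hk : 2 ≤ k) (hkr : k ≤ r) (p : Nat.Primes) :
    eulerFactor r k p =
      ∑ S : Finset (Fin r), thresholdCoeff k S.card * (((p : ℕ) : ℝ)⁻¹) ^ S.card := by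
  rw [← Finset.powerset_univ,
    Finset.sum_powerset_apply_card (fun j => thresholdCoeff k j * (((p : ℕ) : ℝ)⁻¹) ^ j),
    Finset.card_univ, Fintype.card_fin, Finset.sum_range_succ', eulerFactor]
  have h : ∑ m ∈ Finset.range r, r.choose (m + 1) •
      (thresholdCoeff k (m + 1) * (((p : ℕ) : ℝ)⁻¹) ^ (m + 1)) =
      ∑ j ∈ Finset.Icc 1 r, r.choose j • (thresholdCoeff k j * (((p : ℕ) : ℝ)⁻¹) ^ j) := by
    rw [Finset.range_eq_Ico, Finset.sum_Ico_add' (fun j => r.choose j •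
      (thresholdCoeff k j * (((p : ℕ) : ℝ)⁻¹) ^ j)) 0 r 1]
    rfl
  -- The terms with `1 ≤ j < k` vanish; `j = 0` supplies the leading `1`.
  rw [h, ← Finset.sum_subset (Finset.Icc_subset_Icc_left (by omega : 1 ≤ k))]
  · rw [sub_eq_add_neg, add_comm, ← Finset.sum_neg_distrib]
    congr 1
    · refine Finset.sum_congr rfl fun j hj => ?_
      rw [Finset.mem_Icc] at hj
      obtain ⟨k, rfl⟩ := Nat.exists_eq_add_of_le' (by omega : 1 ≤ k)
      obtain ⟨i, rfl⟩ := Nat.exists_eq_add_of_le hj.1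
      rw [show k + 1 + i = (k + i) + 1 by ring, thresholdCoeff_succ_succ,
        show k + i + 1 - (k + 1) = i by omega, show k + i + k + 1 = i + 1 + 2 * k by ring]
      have hsign : (-1 : ℝ) ^ (i + 1 + 2 * k) = -(-1) ^ i := by
        rw [pow_add, pow_mul]
        simp [pow_succ]
      rw [hsign, nsmul_eq_mul, Nat.add_sub_cancel, Nat.add_sub_cancel, one_div, inv_pow]
      ring
    · simp [thresholdCoeff_zero_right (by omega : k ≠ 0)]
  · intro j hj hjk
    rw [Finset.mem_Icc] at hj hjk
    rw [thresholdCoeff_eq_zero (by omega) (by omega)]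
    simp

/-! ### Expanding the count over primes -/

theorem rho_eq_prod_of_le {r k N : ℕ} (hk : 2 ≤ k) {n : Fin r → ℕ}
    (hn : ∀ i, n i ∈ Finset.Icc 1 N) :
    (rho r k n : ℝ) = ∏ p : (N + 1).primesBelow,
      if (Finset.univ.filter fun i => (p : ℕ) ∣ n i).card < k then 1 else 0 := by
  simp only [Finset.mem_Icc] at hn
  have key : ((∀ i, 0 < n i) ∧ KWiseCoprime k n) ↔ ∀ p : (N + 1).primesBelow,
      (Finset.univ.filter fun i => (p : ℕ) ∣ n i).card < k := by
    refine ⟨fun h p => ?_, fun h => ⟨fun i => (hn i).1, fun s hs => ?_⟩⟩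
    · by_contra! hc
      obtain ⟨s, hs, hcard⟩ := Finset.exists_subset_card_eq hc
      have hp := Nat.prime_of_mem_primesBelow p.2
      have : (p : ℕ) ∣ s.gcd n := Finset.dvd_gcd fun i hi => (Finset.mem_filter.1 (hs hi)).2
      rw [h.2 s hcard] at this
      exact hp.one_lt.ne' (Nat.dvd_one.1 this)
    · by_contra hc
      obtain ⟨p, hp, hdvd⟩ := Nat.exists_prime_and_dvd hc
      -- A common prime divisor divides a positive component at most `N`, so primes up to `N`
      -- suffice.
      obtain ⟨i, hi⟩ : s.Nonempty := Finset.card_pos.1 (by omega)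
      have hpi := hdvd.trans (Finset.gcd_dvd hi)
      have hpN := (Nat.le_of_dvd (hn i).1 hpi).trans (hn i).2
      have := h ⟨p, Nat.mem_primesBelow.2 ⟨by omega, hp⟩⟩
      refine this.not_ge (hs ▸ Finset.card_le_card fun j hj => ?_)
      exact Finset.mem_filter.2 ⟨Finset.mem_univ _, hdvd.trans (Finset.gcd_dvd hj)⟩
  rw [rho]
  split_ifs with h
  · rw [Finset.prod_congr rfl fun p _ => if_pos (key.1 h p)]
    simp
  · rw [key] at h
    push Not at h
    obtain ⟨p, hp⟩ := h
    rw [Finset.prod_eq_zero (Finset.mem_univ p) (if_neg hp.not_gt), Nat.cast_zero]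

/-- For an assignment `f` of sets of coordinates to the moduli `q a`, the tuple whose `i`-th
component is the product of the moduli with `i ∈ f a`. -/
def modulusTuple {ι : Type*} [Fintype ι] {r : ℕ} (q : ι → ℕ) (f : ι → Finset (Fin r))
    (i : Fin r) : ℕ :=
  ∏ a with i ∈ f a, q a

theorem modulusTuple_dvd_iff {ι : Type*} [Fintype ι] {r : ℕ} {q : ι → ℕ}
    (hq : Pairwise fun a b => Nat.Coprime (q a) (q b)) (f : ι → Finset (Fin r)) (i : Fin r)
    (m : ℕ) : modulusTuple q f i ∣ m ↔ ∀ a, i ∈ f a → q a ∣ m := by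
  refine ⟨fun h a ha => (Finset.dvd_prod_of_mem q (by simpa using ha)).trans h, fun h => ?_⟩
  refine Finset.prod_dvd_of_isRelPrime (fun a _ b _ hab => ?_) fun a ha => h a (by simpa using ha)
  exact Nat.coprime_iff_isRelPrime.1 (hq hab)

theorem modulusTuple_pos {ι : Type*} [Fintype ι] {r : ℕ} {q : ι → ℕ}
    (hq : ∀ a, 0 < q a) (f : ι → Finset (Fin r)) (i : Fin r) : 0 < modulusTuple q f i :=
  Finset.prod_pos fun a _ => hq a

theorem sum_prod_sum_powerset_dvd {ι : Type*} [Fintype ι] [DecidableEq ι] {r : ℕ} {q : ι → ℕ}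
    (hq : Pairwise fun a b => Nat.Coprime (q a) (q b)) (c : Finset (Fin r) → ℝ) (N : ℕ) :
    ∑ n ∈ Fintype.piFinset (fun _ : Fin r => Finset.Icc 1 N),
        ∏ a, ∑ S ∈ (Finset.univ.filter fun i => q a ∣ n i).powerset, c S =
      ∑ f : ι → Finset (Fin r), (∏ a, c (f a)) * ∏ i, ((N / modulusTuple q f i : ℕ) : ℝ) := by
  have h1 (n : Fin r → ℕ) :
      ∏ a, ∑ S ∈ (Finset.univ.filter fun i => q a ∣ n i).powerset, c S =
        ∑ f : ι → Finset (Fin r), (∏ a, c (f a)) *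
          ∏ i, if modulusTuple q f i ∣ n i then (1 : ℝ) else 0 := by
    have h (a : ι) : ∑ S ∈ (Finset.univ.filter fun i => q a ∣ n i).powerset, c S =
        ∑ S : Finset (Fin r), if ∀ i ∈ S, q a ∣ n i then c S else 0 := by
      rw [← Finset.sum_filter]
      refine Finset.sum_congr ?_ fun _ _ => rfl
      ext S
      simp [Finset.subset_iff]
    simp_rw [h]
    rw [Finset.prod_univ_sum, Fintype.piFinset_univ]
    refine Finset.sum_congr rfl fun f _ => ?_
    by_cases H : ∀ a, ∀ i ∈ f a, q a ∣ n i
    · rw [Finset.prod_congr rfl fun a _ => if_pos (H a), Finset.prod_congr rfl fun i _ =>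
        if_pos ((modulusTuple_dvd_iff hq f i (n i)).2 fun a hi => H a i hi)]
      simp
    · push Not at H
      obtain ⟨a, i, hi, hdvd⟩ := H
      rw [Finset.prod_eq_zero (Finset.mem_univ a) (if_neg fun h => hdvd (h i hi)),
        Finset.prod_eq_zero (Finset.mem_univ i)
          (if_neg fun h => hdvd ((modulusTuple_dvd_iff hq f i (n i)).1 h a hi)), mul_zero]
  simp_rw [h1]
  rw [Finset.sum_comm]
  refine Finset.sum_congr rfl fun f _ => ?_
  rw [← Finset.mul_sum, ← Finset.prod_univ_sum (fun _ : Fin r => Finset.Icc 1 N)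
    (fun i m => if modulusTuple q f i ∣ m then (1 : ℝ) else 0)]
  congr 1
  refine Finset.prod_congr rfl fun i _ => ?_
  rw [Finset.sum_boole, ← Nat.Ioc_filter_dvd_card_eq_div]
  rfl

/-- Refactors a sum over assignments into an Euler product: with all exponents `1` for the main
term, and with one exponent lowered to `ε` for the error. -/
theorem sum_prod_mul_prod_modulusTuple_rpow {ι : Type*} [Fintype ι] [DecidableEq ι] {r : ℕ}
    (q : ι → ℕ) (c : Finset (Fin r) → ℝ) (e : Fin r → ℝ) :
    ∑ f : ι → Finset (Fin r), (∏ a, c (f a)) * ∏ i, (modulusTuple q f i : ℝ) ^ (-e i) =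
      ∏ a, ∑ S : Finset (Fin r), c S * ∏ i ∈ S, (q a : ℝ) ^ (-e i) := by
  rw [Finset.prod_univ_sum, Fintype.piFinset_univ]
  refine Finset.sum_congr rfl fun f _ => ?_
  rw [Finset.prod_mul_distrib]
  congr 1
  have (i : Fin r) : (modulusTuple q f i : ℝ) ^ (-e i) =
      ∏ a, if i ∈ f a then (q a : ℝ) ^ (-e i) else 1 := by
    rw [modulusTuple, Nat.cast_prod, ← Real.finsetProd_rpow _ _ fun _ _ => Nat.cast_nonneg _,
      Finset.prod_filter]
  simp_rw [this]
  rw [Finset.prod_comm]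
  refine Finset.prod_congr rfl fun a _ => ?_
  rw [Finset.prod_ite_mem, Finset.univ_inter]

theorem rhoSum_eq_sum {r k : ℕ} (hk : 2 ≤ k) (x : ℝ) :
    (rhoSum r k x : ℝ) = ∑ f : (⌊x⌋₊ + 1).primesBelow → Finset (Fin r),
      (∏ a, thresholdCoeff k (f a).card) *
        ∏ i, ((⌊x⌋₊ / modulusTuple (fun p : (⌊x⌋₊ + 1).primesBelow => (p : ℕ)) f i : ℕ) : ℝ) := by
  classical
  rw [← sum_prod_sum_powerset_dvd _ (fun S => thresholdCoeff k S.card), rhoSum, Nat.cast_sum]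
  · refine Finset.sum_congr rfl fun n hn => ?_
    rw [rho_eq_prod_of_le hk (Fintype.mem_piFinset.1 hn)]
    simp_rw [sum_powerset_thresholdCoeff]
  · intro a b hab
    exact (Nat.coprime_primes (Nat.prime_of_mem_primesBelow a.2)
      (Nat.prime_of_mem_primesBelow b.2)).2 fun h => hab (Subtype.ext h)

/-! ### The cost of dropping the floors -/

theorem Finset.prod_sub_prod_le_sum {ι : Type*} [DecidableEq ι] (s : Finset ι) {a b : ι → ℝ}
    (hb : ∀ i, 0 ≤ b i) (hba : ∀ i, b i ≤ a i) :
    ∏ i ∈ s, a i - ∏ i ∈ s, b i ≤ ∑ i ∈ s, (a i - b i) * ∏ j ∈ s.erase i, a j := by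
  have ha (i : ι) : 0 ≤ a i := (hb i).trans (hba i)
  induction s using Finset.induction_on with
  | empty => simp
  | insert x s hx ih =>
    rw [Finset.prod_insert hx, Finset.prod_insert hx, Finset.sum_insert hx,
      Finset.erase_insert hx]
    have h : ∑ i ∈ s, (a i - b i) * ∏ j ∈ (insert x s).erase i, a j =
        a x * ∑ i ∈ s, (a i - b i) * ∏ j ∈ s.erase i, a j := by
      rw [Finset.mul_sum]
      refine Finset.sum_congr rfl fun i hi => ?_
      rw [Finset.erase_insert_of_ne fun h : x = i => hx (h ▸ hi),
        Finset.prod_insert fun h => hx (Finset.mem_of_mem_erase h)]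
      ring
    rw [h]
    have h1 : ∏ i ∈ s, b i ≤ ∏ i ∈ s, a i :=
      Finset.prod_le_prod (fun i _ => hb i) fun i _ => hba i
    have h2 := mul_le_mul_of_nonneg_left ih (ha x)
    have h3 := mul_le_mul_of_nonneg_left h1 (sub_nonneg.2 (hba x))
    linarith

/-- The fractional part is at most `min y 1`, and `y ^ ε` dominates this for `0 ≤ ε ≤ 1`. -/
theorem sub_floor_le_rpow {y ε : ℝ} (hy : 0 < y) (hε : 0 ≤ ε) (hε1 : ε ≤ 1) :
    y - ⌊y⌋₊ ≤ y ^ ε := by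
  rcases le_total y 1 with h | h
  · have := Real.rpow_le_rpow_of_exponent_ge hy h hε1
    rw [Real.rpow_one] at this
    linarith [Nat.cast_nonneg (α := ℝ) ⌊y⌋₊]
  · linarith [Real.one_le_rpow h hε, Nat.lt_floor_add_one y]

/-- Replacing one factor at a time, only coordinate `i` carries a fractional part; it contributes
`(x / d i) ^ ε`, whence the exponents `Function.update 1 i ε`. -/
theorem abs_prod_floor_sub_prod_le {r : ℕ} {x ε : ℝ} (hx : 0 < x) (hε : 0 ≤ ε) (hε1 : ε ≤ 1)
    {d : Fin r → ℕ} (hd : ∀ i, 0 < d i) :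
    |∏ i, ((⌊x⌋₊ / d i : ℕ) : ℝ) - x ^ r * ∏ i, (d i : ℝ) ^ (-1 : ℝ)| ≤
      x ^ ((r : ℝ) - 1 + ε) * ∑ i, ∏ j, (d j : ℝ) ^ (-(Function.update 1 i ε : Fin r → ℝ) j) := by
  have hd' (i : Fin r) : (0 : ℝ) < d i := Nat.cast_pos.2 (hd i)
  have hpos (i : Fin r) : 0 < x / d i := div_pos hx (hd' i)
  have hmain : x ^ r * ∏ i, (d i : ℝ) ^ (-1 : ℝ) = ∏ i, x / d i := by
    simp [Real.rpow_neg_one, div_eq_mul_inv, Finset.prod_mul_distrib]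
  simp_rw [← Nat.floor_div_natCast]
  have hle : ∏ i, (⌊x / d i⌋₊ : ℝ) ≤ ∏ i, x / d i :=
    Finset.prod_le_prod (fun i _ => Nat.cast_nonneg _) fun i _ => Nat.floor_le (hpos i).le
  rw [hmain, abs_sub_comm, abs_of_nonneg (sub_nonneg.2 hle), Finset.mul_sum]
  refine (Finset.prod_sub_prod_le_sum _ (fun i => Nat.cast_nonneg _)
    fun i => Nat.floor_le (hpos i).le).trans (Finset.sum_le_sum fun i _ => ?_)
  refine (mul_le_mul_of_nonneg_right (sub_floor_le_rpow (hpos i) hε hε1)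
    (Finset.prod_nonneg fun j _ => (hpos j).le)).trans (le_of_eq ?_)
  rw [← Finset.mul_prod_erase _ _ (Finset.mem_univ i), Function.update_self]
  have hprod : ∏ j ∈ Finset.univ.erase i,
      (d j : ℝ) ^ (-(Function.update 1 i ε : Fin r → ℝ) j) =
      ∏ j ∈ Finset.univ.erase i, (d j : ℝ)⁻¹ := by
    refine Finset.prod_congr rfl fun j hj => ?_
    rw [Function.update_of_ne (Finset.ne_of_mem_erase hj), Pi.one_apply, Real.rpow_neg_one]
  have hr : 1 ≤ r := Nat.one_le_of_lt i.2
  rw [hprod, Real.div_rpow hx.le (hd' i).le, Real.rpow_neg (hd' i).le, Real.rpow_add hx,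
    ← Nat.cast_one, ← Nat.cast_sub hr, Real.rpow_natCast]
  simp only [div_eq_mul_inv, Finset.prod_mul_distrib, Finset.prod_const]
  rw [Finset.card_erase_of_mem (Finset.mem_univ i), Finset.card_univ, Fintype.card_fin]
  ring

theorem abs_rhoSum_sub_le {r k : ℕ} (hk : 2 ≤ k) {x ε : ℝ} (hx : 0 < x) (hε : 0 ≤ ε)
    (hε1 : ε ≤ 1) :
    |(rhoSum r k x : ℝ) - x ^ r * ∏ p ∈ (⌊x⌋₊ + 1).primesBelow,
        ∑ S : Finset (Fin r), thresholdCoeff k S.card * ((p : ℝ)⁻¹) ^ S.card| ≤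
      x ^ ((r : ℝ) - 1 + ε) * ∑ i, ∏ p ∈ (⌊x⌋₊ + 1).primesBelow, ∑ S : Finset (Fin r),
        |thresholdCoeff k S.card| *
          ∏ j ∈ S, (p : ℝ) ^ (-(Function.update 1 i ε : Fin r → ℝ) j) := by
  classical
  have hmain : ∏ p ∈ (⌊x⌋₊ + 1).primesBelow,
        ∑ S : Finset (Fin r), thresholdCoeff k S.card * ((p : ℝ)⁻¹) ^ S.card =
      ∑ f : (⌊x⌋₊ + 1).primesBelow → Finset (Fin r), (∏ a, thresholdCoeff k (f a).card) *
        ∏ i, (modulusTuple (fun p : (⌊x⌋₊ + 1).primesBelow => (p : ℕ)) f i : ℝ) ^ (-1 : ℝ) := by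
    rw [sum_prod_mul_prod_modulusTuple_rpow _ (fun S => thresholdCoeff k S.card) fun _ => 1]
    simp only [Real.rpow_neg_one, Finset.prod_const]
    rw [← Finset.prod_coe_sort]
  have herr (i : Fin r) : ∏ p ∈ (⌊x⌋₊ + 1).primesBelow, ∑ S : Finset (Fin r),
        |thresholdCoeff k S.card| *
          ∏ j ∈ S, (p : ℝ) ^ (-(Function.update 1 i ε : Fin r → ℝ) j) =
      ∑ f : (⌊x⌋₊ + 1).primesBelow → Finset (Fin r), (∏ a, |thresholdCoeff k (f a).card|) *
        ∏ j, (modulusTuple (fun p : (⌊x⌋₊ + 1).primesBelow => (p : ℕ)) f j : ℝ) ^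
          (-(Function.update 1 i ε : Fin r → ℝ) j) := by
    rw [sum_prod_mul_prod_modulusTuple_rpow _ (fun S => |thresholdCoeff k S.card|)
      (Function.update 1 i ε), ← Finset.prod_coe_sort]
  simp_rw [herr]
  rw [hmain, rhoSum_eq_sum hk, Finset.mul_sum, ← Finset.sum_sub_distrib, Finset.sum_comm,
    Finset.mul_sum]
  refine (Finset.abs_sum_le_sum_abs _ _).trans (Finset.sum_le_sum fun f _ => ?_)
  rw [mul_left_comm, ← mul_sub, abs_mul, Finset.abs_prod, ← Finset.mul_sum, mul_left_comm]
  refine mul_le_mul_of_nonneg_left (abs_prod_floor_sub_prod_le hx hε hε1 fun i => ?_)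
    (Finset.prod_nonneg fun _ _ => abs_nonneg _)
  exact modulusTuple_pos (fun a => (Nat.prime_of_mem_primesBelow a.2).pos) f i

/-! ### Bounds for the local factors -/

theorem prod_rpow_update_le_sq {r : ℕ} {q ε : ℝ} (hq : 1 ≤ q) (hε : 0 ≤ ε) {i : Fin r}
    {S : Finset (Fin r)} (hS : 2 ≤ (S.erase i).card) :
    ∏ j ∈ S, q ^ (-(Function.update 1 i ε : Fin r → ℝ) j) ≤ (q ^ 2)⁻¹ := by
  have hq0 : 0 < q := zero_lt_one.trans_le hq
  have hnn (j : Fin r) : 0 ≤ (Function.update 1 i ε : Fin r → ℝ) j := by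
    rcases eq_or_ne j i with rfl | h
    · rwa [Function.update_self]
    · rw [Function.update_of_ne h]
      exact zero_le_one
  have hsum : (2 : ℝ) ≤ ∑ j ∈ S, (Function.update 1 i ε : Fin r → ℝ) j := by
    calc (2 : ℝ) ≤ ((S.erase i).card : ℝ) := by exact_mod_cast hS
      _ = ∑ j ∈ S.erase i, (Function.update 1 i ε : Fin r → ℝ) j := by
        rw [Finset.sum_congr rfl fun j hj =>
          Function.update_of_ne (Finset.ne_of_mem_erase hj) ε (1 : Fin r → ℝ)]
        simp
      _ ≤ _ := Finset.sum_le_sum_of_subset_of_nonneg (Finset.erase_subset i S)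
        fun j _ _ => hnn j
  rw [← Real.rpow_sum_of_pos hq0, Finset.sum_neg_distrib, Real.rpow_neg hq0.le]
  refine inv_anti₀ (by positivity) ?_
  rw [← Real.rpow_natCast]
  exact Real.rpow_le_rpow_of_exponent_le hq (by exact_mod_cast hsum)

theorem sum_univ_two_pow {r : ℕ} (y : ℝ) :
    ∑ _S : Finset (Fin r), 2 ^ r * y = 4 ^ r * y := by
  rw [Finset.sum_const, Finset.card_univ, Fintype.card_finset, Fintype.card_fin, nsmul_eq_mul,
    ← mul_assoc]
  push_cast
  rw [← mul_pow]
  norm_num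

theorem abs_thresholdCoeff_card_le {r : ℕ} (k : ℕ) (S : Finset (Fin r)) :
    |thresholdCoeff k S.card| ≤ 2 ^ r :=
  (abs_thresholdCoeff_le k _).trans
    (pow_le_pow_right₀ one_le_two (by simpa using Finset.card_le_univ S))

theorem abs_sum_thresholdCoeff_sub_one_le {r k : ℕ} (hk : 2 ≤ k) {q : ℝ} (hq : 1 ≤ q) :
    |∑ S : Finset (Fin r), thresholdCoeff k S.card * (q⁻¹) ^ S.card - 1| ≤
      4 ^ r * (q ^ 2)⁻¹ := by
  have hone : (1 : ℝ) = ∑ S : Finset (Fin r), if S = ∅ then 1 else 0 := by simp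
  rw [hone, ← Finset.sum_sub_distrib, ← sum_univ_two_pow]
  refine (Finset.abs_sum_le_sum_abs _ _).trans (Finset.sum_le_sum fun S _ => ?_)
  have hnn : (0 : ℝ) ≤ 2 ^ r * (q ^ 2)⁻¹ := by positivity
  split_ifs with h
  · simpa [h, thresholdCoeff_zero_right (by omega : k ≠ 0)] using hnn
  · rw [sub_zero]
    rcases lt_or_ge S.card k with hS | hS
    · rw [thresholdCoeff_eq_zero (by simpa using h) hS]
      simpa using hnn
    · rw [abs_mul, abs_of_nonneg (by positivity : 0 ≤ q⁻¹ ^ S.card), ← inv_pow]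
      exact mul_le_mul (abs_thresholdCoeff_card_le k S)
        (pow_le_pow_of_le_one (by positivity) (inv_le_one_of_one_le₀ hq) (by omega))
        (by positivity) (by positivity)

theorem sum_abs_thresholdCoeff_le_of_three_le {r k : ℕ} (hk : 3 ≤ k) {q ε : ℝ} (hq : 1 ≤ q)
    (hε : 0 ≤ ε) (i : Fin r) :
    ∑ S : Finset (Fin r), |thresholdCoeff k S.card| *
        ∏ j ∈ S, q ^ (-(Function.update 1 i ε : Fin r → ℝ) j) ≤
      1 + 4 ^ r * (q ^ 2)⁻¹ := by
  have hone : (1 : ℝ) = ∑ S : Finset (Fin r), if S = ∅ then 1 else 0 := by simp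
  rw [hone, ← sum_univ_two_pow, ← Finset.sum_add_distrib]
  refine Finset.sum_le_sum fun S _ => ?_
  have hnn : (0 : ℝ) ≤ 2 ^ r * (q ^ 2)⁻¹ := by positivity
  split_ifs with h
  · simpa [h, thresholdCoeff_zero_right (by omega : k ≠ 0)] using hnn
  · rcases lt_or_ge S.card k with hS | hS
    · rw [thresholdCoeff_eq_zero (by simpa using h) hS]
      simpa using hnn
    · rw [zero_add]
      have := Finset.pred_card_le_card_erase (s := S) (a := i)
      exact mul_le_mul (abs_thresholdCoeff_card_le k S)
        (prod_rpow_update_le_sq hq hε (by omega)) (Finset.prod_nonneg fun _ _ => by positivity)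
        (by positivity)

/-- Only the pairs `{i, j}` lack two full exponents. There are at most `r - 1` of them, each with
coefficient `-1`. -/
theorem sum_abs_thresholdCoeff_two_le {r : ℕ} {q ε : ℝ} (hq : 1 ≤ q) (hε : 0 ≤ ε) (i : Fin r) :
    ∑ S : Finset (Fin r), |thresholdCoeff 2 S.card| *
        ∏ j ∈ S, q ^ (-(Function.update 1 i ε : Fin r → ℝ) j) ≤
      1 + ((r - 1 : ℕ) : ℝ) * q ^ (-(1 + ε)) + 4 ^ r * (q ^ 2)⁻¹ := by
  have hq0 : 0 < q := zero_lt_one.trans_le hq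
  set y := q ^ (-(1 + ε)) with hy
  have hone : (1 : ℝ) = ∑ S : Finset (Fin r), if S = ∅ then 1 else 0 := by simp
  set T : Finset (Finset (Fin r)) := (Finset.univ.erase i).image fun j => {i, j} with hT
  have hTcard : T.card ≤ r - 1 := by
    refine Finset.card_image_le.trans (le_of_eq ?_)
    rw [Finset.card_erase_of_mem (Finset.mem_univ i), Finset.card_univ, Fintype.card_fin]
  have hpairs : ∑ S : Finset (Fin r), (if S ∈ T then y else 0) ≤
      ((r - 1 : ℕ) : ℝ) * y := by
    rw [Finset.sum_ite_mem, Finset.univ_inter, Finset.sum_const, nsmul_eq_mul]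
    gcongr
  refine le_trans ?_ (add_le_add_left (add_le_add_right hpairs 1) _)
  rw [hone, ← sum_univ_two_pow, ← Finset.sum_add_distrib, ← Finset.sum_add_distrib]
  refine Finset.sum_le_sum fun S _ => ?_
  have hnn : (0 : ℝ) ≤ 2 ^ r * (q ^ 2)⁻¹ := by positivity
  have hnn' : (0 : ℝ) ≤ if S ∈ T then y else 0 := by positivity
  by_cases h : S = ∅
  · have : |thresholdCoeff 2 S.card| *
        ∏ j ∈ S, q ^ (-(Function.update 1 i ε : Fin r → ℝ) j) = 1 := by
      simp [h, thresholdCoeff_zero_right]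
    rw [this, if_pos h]
    linarith
  rw [if_neg h, zero_add]
  rcases lt_or_ge S.card 2 with hS | hS
  · rw [thresholdCoeff_eq_zero (by simpa using h) hS, abs_zero, zero_mul]
    linarith
  rcases lt_or_ge (S.erase i).card 2 with hS' | hS'
  · have hiS : i ∈ S := by
      by_contra hi
      rw [Finset.erase_eq_of_notMem hi] at hS'
      omega
    have hc := Finset.card_erase_add_one hiS
    obtain ⟨j, hj⟩ := Finset.card_eq_one.1 (by omega : (S.erase i).card = 1)
    have hji : j ≠ i := Finset.ne_of_mem_erase (hj ▸ Finset.mem_singleton_self j)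
    have hSeq : S = {i, j} := by rw [← Finset.insert_erase hiS, hj]
    have hST : S ∈ T :=
      Finset.mem_image.2 ⟨j, Finset.mem_erase.2 ⟨hji, Finset.mem_univ j⟩, hSeq.symm⟩
    rw [if_pos hST, hSeq, Finset.card_pair hji.symm, Finset.prod_pair hji.symm,
      Function.update_self, Function.update_of_ne hji, Pi.one_apply, ← Real.rpow_add hq0,
      ← neg_add, add_comm ε 1, ← hy]
    simpa [thresholdCoeff] using hnn
  · refine le_add_of_nonneg_of_le hnn' ?_
    exact mul_le_mul (abs_thresholdCoeff_card_le 2 S) (prod_rpow_update_le_sq hq hε hS')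
      (Finset.prod_nonneg fun _ _ => by positivity) (by positivity)

/-! ### Products and sums over primes -/

/-- The integral comparison for the zeta series, with the subtracted tail kept so that the induction
telescopes. The term at `0` is zero by convention. -/
theorem sum_rpow_neg_one_add_le {ε : ℝ} (hε : 0 < ε) (N : ℕ) :
    ∑ n ∈ Finset.range (N + 2), (n : ℝ) ^ (-(1 + ε)) ≤
      1 + ε⁻¹ - ε⁻¹ * ((N + 1 : ℕ) : ℝ) ^ (-ε) := by
  induction N with
  | zero =>
    rw [Finset.sum_range_succ, Finset.sum_range_one]
    simp [Real.zero_rpow (by linarith : -ε + -1 ≠ 0)]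
  | succ N ih =>
    rw [Finset.sum_range_succ]
    have hN : (0 : ℝ) < ((N + 1 : ℕ) : ℝ) := by positivity
    have hM : (0 : ℝ) < ((N + 2 : ℕ) : ℝ) := by positivity
    have hNM : ((N + 2 : ℕ) : ℝ) = ((N + 1 : ℕ) : ℝ) + 1 := by push_cast; ring
    set a := ((N + 1 : ℕ) : ℝ)
    set b := ((N + 2 : ℕ) : ℝ)
    have h1 : 1 + ε * b⁻¹ ≤ (b / a) ^ ε := by
      have hlog : b⁻¹ ≤ Real.log (b / a) := by
        have := Real.one_sub_inv_le_log_of_pos (div_pos hM hN)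
        refine le_trans (le_of_eq ?_) this
        field_simp
        linarith
      rw [Real.rpow_def_of_pos (div_pos hM hN)]
      have := Real.add_one_le_exp (Real.log (b / a) * ε)
      nlinarith [mul_le_mul_of_nonneg_left hlog hε.le]
    have h2 : b ^ (-(1 + ε)) ≤ ε⁻¹ * a ^ (-ε) - ε⁻¹ * b ^ (-ε) := by
      rw [Real.div_rpow hM.le hN.le] at h1
      have hb : 0 < b ^ (-ε) := Real.rpow_pos_of_pos hM _
      have h3 := mul_le_mul_of_nonneg_left h1 hb.le
      have h4 : b ^ (-ε) * (b ^ ε / a ^ ε) = a ^ (-ε) := by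
        rw [Real.rpow_neg hM.le, Real.rpow_neg hN.le]
        field_simp
      have h5 : b ^ (-(1 + ε)) = b⁻¹ * b ^ (-ε) := by
        rw [neg_add, Real.rpow_add hM, Real.rpow_neg_one]
      rw [h4] at h3
      rw [h5, ← mul_sub, le_inv_mul_iff₀ hε]
      linarith
    change _ + b ^ (-(1 + ε)) ≤ 1 + ε⁻¹ - ε⁻¹ * b ^ (-ε)
    linarith

theorem tsum_rpow_neg_one_add_le {ε : ℝ} (hε : 0 < ε) :
    ∑' n : ℕ, (n : ℝ) ^ (-(1 + ε)) ≤ 1 + ε⁻¹ := by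
  refine Real.tsum_le_of_sum_range_le (fun n => by positivity) fun N => ?_
  refine (Finset.sum_le_sum_of_subset_of_nonneg (Finset.range_subset_range.2 (Nat.le_add_right N 2))
    fun n _ _ => by positivity).trans ((sum_rpow_neg_one_add_le hε N).trans ?_)
  have : 0 ≤ ε⁻¹ * ((N + 1 : ℕ) : ℝ) ^ (-ε) := by positivity
  linarith

/-- Since `1 + t ≤ (1 - t)⁻¹`, the product is at most a sum over smooth numbers, hence at most the
full zeta series. -/
theorem prod_primesBelow_one_add_rpow_le {ε : ℝ} (hε : 0 < ε) (N : ℕ) :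
    ∏ p ∈ N.primesBelow, (1 + (p : ℝ) ^ (-(1 + ε))) ≤ 1 + ε⁻¹ := by
  let f : ℕ →* ℝ :=
    { toFun := fun n => (n : ℝ) ^ (-(1 + ε))
      map_one' := by simp
      map_mul' := fun m n => by
        rw [Nat.cast_mul, Real.mul_rpow (Nat.cast_nonneg m) (Nat.cast_nonneg n)] }
  have hsum : Summable f := Real.summable_nat_rpow.2 (by linarith)
  have hnn (n : ℕ) : 0 ≤ f n := Real.rpow_nonneg (Nat.cast_nonneg n) _
  calc ∏ p ∈ N.primesBelow, (1 + (p : ℝ) ^ (-(1 + ε)))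
      ≤ ∏ p ∈ N.primesBelow, (1 - f p)⁻¹ := by
        refine Finset.prod_le_prod (fun p _ => by positivity) fun p hp => ?_
        have hlt : f p < 1 := by
          simpa [abs_of_nonneg (hnn p)] using
            hsum.norm_lt_one (Nat.prime_of_mem_primesBelow hp).one_lt
        change 1 + f p ≤ _
        rw [← one_div, le_div_iff₀ (by linarith)]
        nlinarith [sq_nonneg (f p)]
    _ = ∑' m : N.smoothNumbers, f m :=
        EulerProduct.prod_primesBelow_geometric_eq_tsum_smoothNumbers hsum N
    _ ≤ ∑' m : ℕ, f m := hsum.tsum_subtype_le f N.smoothNumbers hnn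
    _ ≤ 1 + ε⁻¹ := tsum_rpow_neg_one_add_le hε

theorem sum_inv_sq_le_of_lt {s : Finset ℕ} {N : ℕ} (hs : ∀ n ∈ s, N < n) :
    ∑ n ∈ s, ((n : ℝ) ^ 2)⁻¹ ≤ 2 / (N + 1) := by
  refine (Finset.sum_le_sum_of_subset_of_nonneg (fun n hn => ?_) fun n _ _ => by positivity).trans
    (sum_Ioo_inv_sq_le N (s.sup id + 1))
  exact Finset.mem_Ioo.2 ⟨hs n hn, Nat.lt_succ_of_le (Finset.le_sup (f := id) hn)⟩

theorem sum_primes_inv_sq_le_of_lt {s : Finset Nat.Primes} {N : ℕ}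
    (hs : ∀ p ∈ s, N < (p : ℕ)) : ∑ p ∈ s, (((p : ℕ) : ℝ) ^ 2)⁻¹ ≤ 2 / (N + 1) := by
  let e : Nat.Primes ↪ ℕ := ⟨fun p => (p : ℕ), Nat.Primes.coe_nat_injective⟩
  have h := sum_inv_sq_le_of_lt (s := s.map e) (N := N)
    fun n hn => by
      obtain ⟨p, hp, rfl⟩ := Finset.mem_map.1 hn
      exact hs p hp
  rwa [Finset.sum_map] at h

theorem prod_primesBelow_one_add_inv_sq_le {K : ℝ} (hK : 0 ≤ K) (N : ℕ) :
    ∏ p ∈ N.primesBelow, (1 + K * ((p : ℝ) ^ 2)⁻¹) ≤ Real.exp (2 * K) := by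
  refine (Real.prod_one_add_le_exp_sum _ fun p => by positivity).trans (Real.exp_le_exp.2 ?_)
  have := sum_inv_sq_le_of_lt (s := N.primesBelow) (N := 0)
    fun p hp => (Nat.prime_of_mem_primesBelow hp).pos
  rw [← Finset.mul_sum, mul_comm 2 K]
  refine mul_le_mul_of_nonneg_left (this.trans ?_) hK
  norm_num

/-! ### Convergence and tail of the Euler product -/

theorem abs_eulerFactor_sub_one_le {r k : ℕ} (hk : 2 ≤ k) (hkr : k ≤ r) (p : Nat.Primes) :
    |eulerFactor r k p - 1| ≤ 4 ^ r * (((p : ℕ) : ℝ) ^ 2)⁻¹ := by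
  rw [eulerFactor_eq_sum hk hkr]
  exact abs_sum_thresholdCoeff_sub_one_le hk (by exact_mod_cast p.2.one_lt.le)

theorem multipliable_eulerFactor {r k : ℕ} (hk : 2 ≤ k) (hkr : k ≤ r) :
    Multipliable (eulerFactor r k) := by
  have hsum : Summable fun p : Nat.Primes => eulerFactor r k p - 1 := by
    refine Summable.of_norm_bounded (g := fun p : Nat.Primes => 4 ^ r * (((p : ℕ) : ℝ) ^ 2)⁻¹)
      (Summable.mul_left _ ?_) fun p => abs_eulerFactor_sub_one_le hk hkr p
    exact (Real.summable_nat_pow_inv.2 one_lt_two).comp_injective Subtype.val_injective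
  simpa using Real.multipliable_one_add_of_summable hsum

theorem exp_sub_one_le_mul_exp {t : ℝ} : Real.exp t - 1 ≤ t * Real.exp t := by
  have h := mul_le_mul_of_nonneg_right (Real.one_sub_le_exp_neg t) (Real.exp_pos t).le
  rw [← Real.exp_add, neg_add_cancel, Real.exp_zero] at h
  linarith

theorem abs_prod_eulerFactor_sub_one_le {r k N : ℕ} (hk : 2 ≤ k) (hkr : k ≤ r)
    {s : Finset Nat.Primes} (hs : ∀ p ∈ s, N < (p : ℕ)) :
    |∏ p ∈ s, eulerFactor r k p - 1| ≤ 2 * 4 ^ r / (N + 1) * Real.exp (2 * 4 ^ r) := by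
  have h := s.norm_prod_one_add_sub_one_le fun p => eulerFactor r k p - 1
  simp only [add_sub_cancel, Real.norm_eq_abs] at h
  have hsum : ∑ p ∈ s, |eulerFactor r k p - 1| ≤ 2 * 4 ^ r / (N + 1) := by
    refine (Finset.sum_le_sum fun p _ => abs_eulerFactor_sub_one_le hk hkr p).trans ?_
    rw [← Finset.mul_sum, mul_comm 2, mul_div_assoc]
    exact mul_le_mul_of_nonneg_left (sum_primes_inv_sq_le_of_lt hs) (by positivity)
  refine (h.trans exp_sub_one_le_mul_exp).trans ?_
  have hN : 2 * 4 ^ r / ((N : ℝ) + 1) ≤ 2 * 4 ^ r :=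
    div_le_self (by positivity) (by linarith [Nat.cast_nonneg (α := ℝ) N])
  exact mul_le_mul hsum (Real.exp_le_exp.2 (hsum.trans hN)) (Real.exp_pos _).le (by positivity)

theorem abs_prod_primesBelow_sub_mainConst_le {r k : ℕ} (hk : 2 ≤ k) (hkr : k ≤ r) (N : ℕ) :
    |∏ p ∈ (N + 1).primesBelow, (∑ S : Finset (Fin r), thresholdCoeff k S.card *
        ((p : ℝ)⁻¹) ^ S.card) - mainConst r k| ≤
      Real.exp (2 * 4 ^ r) * (2 * 4 ^ r / (N + 1) * Real.exp (2 * 4 ^ r)) := by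
  set P : Finset Nat.Primes := (N + 1).primesBelow.subtype Nat.Prime with hP
  have hprod : ∏ p ∈ (N + 1).primesBelow, (∑ S : Finset (Fin r), thresholdCoeff k S.card *
      ((p : ℝ)⁻¹) ^ S.card) = ∏ p ∈ P, eulerFactor r k p := by
    rw [Finset.prod_congr rfl fun p _ => eulerFactor_eq_sum hk hkr p]
    exact (Finset.prod_subtype_of_mem _ fun p hp => Nat.prime_of_mem_primesBelow hp).symm
  have hPle : |∏ p ∈ P, eulerFactor r k p| ≤ Real.exp (2 * 4 ^ r) := by
    rw [← hprod, Finset.abs_prod]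
    refine (Finset.prod_le_prod (fun _ _ => abs_nonneg _) fun p hp => ?_).trans
      (prod_primesBelow_one_add_inv_sq_le (by positivity : (0 : ℝ) ≤ 4 ^ r) (N + 1))
    have hp1 : (1 : ℝ) ≤ p := by exact_mod_cast (Nat.prime_of_mem_primesBelow hp).one_lt.le
    have h1 := abs_sum_thresholdCoeff_sub_one_le (r := r) hk hp1
    have h2 := abs_sub_abs_le_abs_sub (∑ S : Finset (Fin r), thresholdCoeff k S.card *
      ((p : ℝ)⁻¹) ^ S.card) 1
    rw [abs_one] at h2
    linarith
  rw [hprod]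
  have hlim := ((multipliable_eulerFactor hk hkr).hasProd.const_sub
    (∏ p ∈ P, eulerFactor r k p)).abs
  -- Every finite set of primes containing `P` satisfies the bound, because its extra primes exceed
  -- `N`; the bound then passes to the limit.
  refine le_of_tendsto hlim (Filter.eventually_atTop.2 ⟨P, fun F hF => ?_⟩)
  rw [← Finset.prod_sdiff hF, abs_sub_comm, ← sub_one_mul, abs_mul, mul_comm]
  refine mul_le_mul hPle (abs_prod_eulerFactor_sub_one_le hk hkr fun p hp => ?_) (abs_nonneg _)
    (Real.exp_pos _).le
  by_contra hc
  refine (Finset.mem_sdiff.1 hp).2 (Finset.mem_subtype.2 (Nat.mem_primesBelow.2 ⟨?_, p.2⟩))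
  omega

/-! ### Error products and the final estimate -/

theorem prod_sum_abs_thresholdCoeff_le_of_three_le {r k : ℕ} (hk : 3 ≤ k) {ε : ℝ}
    (hε : 0 ≤ ε) (i : Fin r) (N : ℕ) :
    ∏ p ∈ N.primesBelow, ∑ S : Finset (Fin r), |thresholdCoeff k S.card| *
        ∏ j ∈ S, (p : ℝ) ^ (-(Function.update 1 i ε : Fin r → ℝ) j) ≤
      Real.exp (2 * 4 ^ r) := by
  refine (Finset.prod_le_prod (fun p _ => ?_) fun p hp => ?_).trans
    (prod_primesBelow_one_add_inv_sq_le (by positivity : (0 : ℝ) ≤ 4 ^ r) N)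
  · exact Finset.sum_nonneg fun S _ => mul_nonneg (abs_nonneg _)
      (Finset.prod_nonneg fun j _ => by positivity)
  · exact sum_abs_thresholdCoeff_le_of_three_le hk
      (by exact_mod_cast (Nat.prime_of_mem_primesBelow hp).one_lt.le) hε i

theorem prod_sum_abs_thresholdCoeff_two_le {r : ℕ} {ε : ℝ} (hε : 0 < ε) (i : Fin r) (N : ℕ) :
    ∏ p ∈ N.primesBelow, ∑ S : Finset (Fin r), |thresholdCoeff 2 S.card| *
        ∏ j ∈ S, (p : ℝ) ^ (-(Function.update 1 i ε : Fin r → ℝ) j) ≤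
      (1 + ε⁻¹) ^ (r - 1) * Real.exp (2 * 4 ^ r) := by
  calc _ ≤ ∏ p ∈ N.primesBelow, ((1 + (p : ℝ) ^ (-(1 + ε))) ^ (r - 1) *
        (1 + 4 ^ r * ((p : ℝ) ^ 2)⁻¹)) := by
        refine Finset.prod_le_prod (fun p _ => ?_) fun p hp => ?_
        · exact Finset.sum_nonneg fun S _ => mul_nonneg (abs_nonneg _)
            (Finset.prod_nonneg fun j _ => by positivity)
        · refine (sum_abs_thresholdCoeff_two_le
            (by exact_mod_cast (Nat.prime_of_mem_primesBelow hp).one_lt.le) hε.le i).trans ?_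
          have hy : 0 ≤ (p : ℝ) ^ (-(1 + ε)) := by positivity
          have hz : 0 ≤ 4 ^ r * ((p : ℝ) ^ 2)⁻¹ := by positivity
          -- Bernoulli's inequality turns the `r - 1` pairs into an `(r - 1)`-st power of a
          -- zeta-type factor.
          have hb := one_add_mul_le_pow (by linarith : -2 ≤ (p : ℝ) ^ (-(1 + ε))) (r - 1)
          refine le_trans ?_ (mul_le_mul_of_nonneg_right hb (by linarith))
          have := mul_nonneg (mul_nonneg (Nat.cast_nonneg (α := ℝ) (r - 1)) hy) hz
          linarith
    _ = (∏ p ∈ N.primesBelow, (1 + (p : ℝ) ^ (-(1 + ε)))) ^ (r - 1) *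
        ∏ p ∈ N.primesBelow, (1 + 4 ^ r * ((p : ℝ) ^ 2)⁻¹) := by
        rw [Finset.prod_mul_distrib, Finset.prod_pow]
    _ ≤ _ := by
        refine mul_le_mul (pow_le_pow_left₀ (Finset.prod_nonneg fun p _ => by positivity)
            (prod_primesBelow_one_add_rpow_le hε N) _)
          (prod_primesBelow_one_add_inv_sq_le (by positivity) N)
          (Finset.prod_nonneg fun p _ => by positivity) (by positivity)

theorem abs_rhoSum_sub_mainConst_le {r k : ℕ} (hk : 2 ≤ k) (hkr : k ≤ r) {x ε B : ℝ} (hx : 2 ≤ x)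
    (hε : 0 ≤ ε) (hε1 : ε ≤ 1)
    (hB : ∀ i, ∏ p ∈ (⌊x⌋₊ + 1).primesBelow, ∑ S : Finset (Fin r), |thresholdCoeff k S.card| *
      ∏ j ∈ S, (p : ℝ) ^ (-(Function.update 1 i ε : Fin r → ℝ) j) ≤ B) :
    |(rhoSum r k x : ℝ) - mainConst r k * x ^ r| ≤
      x ^ (r - 1) * (r * (x ^ ε * B) + 2 * 4 ^ r * Real.exp (2 * 4 ^ r) ^ 2) := by
  have hx0 : 0 < x := by linarith
  have hr : 1 ≤ r := by omega
  set Q := ∏ p ∈ (⌊x⌋₊ + 1).primesBelow,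
    ∑ S : Finset (Fin r), thresholdCoeff k S.card * ((p : ℝ)⁻¹) ^ S.card
  have h1 : |(rhoSum r k x : ℝ) - x ^ r * Q| ≤ x ^ (r - 1) * (r * (x ^ ε * B)) := by
    refine (abs_rhoSum_sub_le hk hx0 hε hε1).trans ?_
    rw [Real.rpow_add hx0, ← Nat.cast_one, ← Nat.cast_sub hr, Real.rpow_natCast]
    have := Finset.sum_le_card_nsmul Finset.univ _ B fun i _ => hB i
    rw [Finset.card_univ, Fintype.card_fin, nsmul_eq_mul] at this
    refine (mul_le_mul_of_nonneg_left this (by positivity)).trans (le_of_eq ?_)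
    ring
  have h2 : |x ^ r * (Q - mainConst r k)| ≤
      x ^ (r - 1) * (2 * 4 ^ r * Real.exp (2 * 4 ^ r) ^ 2) := by
    have hN : 2 * 4 ^ r / ((⌊x⌋₊ : ℝ) + 1) ≤ 2 * 4 ^ r / x :=
      div_le_div_of_nonneg_left (by positivity) hx0 (Nat.lt_floor_add_one x).le
    rw [abs_mul, abs_of_pos (pow_pos hx0 r)]
    calc x ^ r * |Q - mainConst r k|
        ≤ x ^ r * (Real.exp (2 * 4 ^ r) * (2 * 4 ^ r / x * Real.exp (2 * 4 ^ r))) := by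
          refine mul_le_mul_of_nonneg_left
            ((abs_prod_primesBelow_sub_mainConst_le hk hkr _).trans ?_) (by positivity)
          gcongr
      _ = _ := by
          rw [← Nat.sub_add_cancel hr, pow_succ, Nat.add_sub_cancel]
          field_simp
  rw [mul_add]
  refine le_trans (le_of_eq ?_) ((abs_add_le _ _).trans (add_le_add h1 h2))
  congr 1
  ring

theorem theorem2 (r : ℕ) (hr : 2 ≤ r) :
    (∀ k : ℕ, 2 ≤ k → k ≤ r → Multipliable (eulerFactor r k)) ∧
    ∃ C : ℝ, 0 < C ∧ ∀ k : ℕ, 2 ≤ k → k ≤ r → ∀ x : ℝ, 2 ≤ x →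
      |(rhoSum r k x : ℝ) - mainConst r k * x ^ r| ≤ C * errorBound r k x := by
  refine ⟨fun k hk hkr => multipliable_eulerFactor hk hkr, ?_⟩
  set E := Real.exp (2 * 4 ^ r) with hE
  have hE0 : 0 < E := Real.exp_pos _
  -- The factor `4 ^ (r - 1)` comes from `1 + ε⁻¹ ≤ 4 * log x` when `k = 2`; it is only slack when
  -- `k ≥ 3`.
  refine ⟨4 ^ (r - 1) * (r * (Real.exp 1 * E) + 2 * 4 ^ r * E ^ 2), by positivity,
    fun k hk hkr x hx => ?_⟩
  have hx0 : 0 < x := by linarith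
  have hexp : 1 ≤ Real.exp 1 := Real.one_le_exp zero_le_one
  rcases Nat.lt_or_ge 2 k with hk3 | hk3
  · rw [errorBound, if_pos (by omega)]
    refine (abs_rhoSum_sub_mainConst_le hk hkr hx le_rfl zero_le_one fun i =>
      prod_sum_abs_thresholdCoeff_le_of_three_le hk3 le_rfl i _).trans ?_
    rw [Real.rpow_zero, mul_comm, ← hE]
    refine mul_le_mul_of_nonneg_right ?_ (by positivity)
    refine le_trans ?_ (le_mul_of_one_le_left (by positivity)
      (one_le_pow₀ (by norm_num : (1 : ℝ) ≤ 4)))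
    gcongr
  · obtain rfl : k = 2 := le_antisymm hk3 hk
    rw [errorBound, if_neg (by omega)]
    have hlog : 1 / 2 ≤ Real.log x := by
      have := Real.log_le_log two_pos hx
      linarith [Real.log_two_gt_d9]
    have hlog0 : 0 < Real.log x := by linarith
    -- This keeps `x ^ ε` bounded while `ε⁻¹` is of order `log x`; the `2` ensures `ε ≤ 1` down to
    -- `x = 2`.
    set ε := (2 * Real.log x)⁻¹ with hεdef
    have hε : 0 < ε := by positivity
    have hε1 : ε ≤ 1 := inv_le_one_of_one_le₀ (by linarith)
    have hxε : x ^ ε ≤ Real.exp 1 := by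
      rw [Real.rpow_def_of_pos hx0, Real.exp_le_exp, hεdef, mul_inv_le_iff₀ (by positivity)]
      linarith
    have hinv : 1 + ε⁻¹ ≤ 4 * Real.log x := by
      rw [hεdef, inv_inv]
      linarith
    have h4 : 1 ≤ (4 * Real.log x) ^ (r - 1) := one_le_pow₀ (by linarith)
    refine (abs_rhoSum_sub_mainConst_le hk hkr hx hε.le hε1 fun i =>
      prod_sum_abs_thresholdCoeff_two_le hε i _).trans ?_
    rw [← hE]
    calc x ^ (r - 1) * (r * (x ^ ε * ((1 + ε⁻¹) ^ (r - 1) * E)) + 2 * 4 ^ r * E ^ 2)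
        ≤ x ^ (r - 1) * (r * (Real.exp 1 * ((4 * Real.log x) ^ (r - 1) * E)) +
          (4 * Real.log x) ^ (r - 1) * (2 * 4 ^ r * E ^ 2)) := by
          refine mul_le_mul_of_nonneg_left (add_le_add ?_ ?_) (by positivity)
          · gcongr
          · exact le_mul_of_one_le_left (by positivity) h4
      _ = _ := by
          rw [mul_pow]
          ring
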